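/- Let $\mathbb{T}=\mathbb{R}/\mathbb{Z}$, let $\mathcal{S}(\mathbb{T})$ be the space of infinitely smooth complex-valued functions on $\mathbb{T}$ with its usual Fréchet topology (uniform convergence of all derivatives), and let $\mathcal{S}'(\mathbb{T})$ be its topological dual, the space of periodic generalized functions; a smooth function $g$ is identified with the generalized function $h\mapsto\int_{\mathbb{T}} g\,h$. For $f\in\mathcal{S}'(\mathbb{T})$ write $\widehat f_k=\langle f,\mathrm{e}^{-2\mathrm{i}\pi k\cdot}\rangle$, $k\in\mathbb{Z}$. Fix non-negative Schwartz functions $\varphi_0,\varphi\in\mathcal{S}(\mathbb{R})$ with $\mathrm{Supp}\,\varphi_0\subset\{|x|\le 2\}$, $\mathrm{Supp}\,\varphi\subset\{\tfrac12\le|x|\le2\}$, and $\sum_{j\ge0}\varphi_j=1$ on $\mathbb{R}$, where $\varphi_j=\varphi(2^{-j}\,\cdot)$ for $j\ge1$. For $0<p,q\le\infty$ and $s\in\mathbb{R}$, the Besov space $B^s_{p,q}(\mathbb{T})$ is the set of $f\in\mathcal{S}'(\mathbb{T})$ such that $$\|f\|_{B^s_{p,q}}=\Bigl(\sum_{j\ge0}2^{jsq}\Bigl\|\sum_{k\in\mathbb{Z}}\varphi_j(k)\widehat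 f_k\,\mathrm{e}^{2\mathrm{i}\pi k\cdot}\Bigr\|_{L_p(\mathbb{T})}^q\Bigr)^{1/q}<\infty$$ (with $\sup_{j\ge0}2^{js}\|\cdot\|_{L_p(\mathbb{T})}$ if $q=\infty$). The critical smoothness of $f$ at $p\in(0,\infty]$ is $$s_f(p)=\sup\{s\in\mathbb{R}:\ f\in B^s_{p,q}(\mathbb{T})\}\in(-\infty,\infty],$$ which does not depend on $q\in(0,\infty]$. **Proposition.** Let $f\in\mathcal{S}'(\mathbb{T})$. If $f\in\mathcal{S}(\mathbb{T})$, then $s_f(p)=\infty$ for every $0<p\le\infty$. Conversely, if there exists some $0<p_0\le\infty$ such that $s_f(p_0)=\infty$, then $s_f(p)=\infty$ for every $0<p\le\infty$ and $f\in\mathcal{S}(\mathbb{T})$. -/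

import Mathlib

open scoped ENNReal ContDiff SchwartzMap
open MeasureTheory

noncomputable section

namespace PeriodicBesov

/-- The space `S(𝕋)` of infinitely smooth complex-valued functions on the torus `𝕋 = ℝ / ℤ`. -/
structure SmoothPeriodic where
  /-- the underlying function on the torus -/
  toFun : UnitAddCircle → ℂ
  /-- its 1-periodic representative on the line is infinitely differentiable -/
  smooth : ContDiff ℝ ∞ (fun x : ℝ => toFun (x : UnitAddCircle))

namespace SmoothPeriodic

instance : CoeFun SmoothPeriodic (fun _ => UnitAddCircle → ℂ) := ⟨toFun⟩

@[ext]
theorem ext {g h : SmoothPeriodic} (H : ∀ t, g t = h t) : g = h := by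
  cases g; cases h
  congr 1
  exact funext H

theorem toFun_injective : Function.Injective toFun :=
  fun _ _ H => ext fun t => congrFun H t

instance : Zero SmoothPeriodic := ⟨⟨fun _ => 0, contDiff_const⟩⟩
instance : Add SmoothPeriodic := ⟨fun g h => ⟨fun t => g t + h t, g.smooth.add h.smooth⟩⟩
instance : Neg SmoothPeriodic := ⟨fun g => ⟨fun t => - g t, g.smooth.neg⟩⟩
instance : Sub SmoothPeriodic := ⟨fun g h => ⟨fun t => g t - h t, g.smooth.sub h.smooth⟩⟩
instance {R : Type*} [Monoid R] [DistribMulAction R ℂ] [SMulCommClass ℝ R ℂ]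
    [ContinuousConstSMul R ℂ] : SMul R SmoothPeriodic :=
  ⟨fun c g => ⟨fun t => c • g t, g.smooth.const_smul c⟩⟩

instance : AddCommGroup SmoothPeriodic :=
  toFun_injective.addCommGroup toFun rfl (fun _ _ => rfl) (fun _ => rfl) (fun _ _ => rfl)
    (fun _ _ => rfl) (fun _ _ => rfl)

/-- The additive map sending an element of `S(𝕋)` to its underlying function. -/
def coeHom : SmoothPeriodic →+ (UnitAddCircle → ℂ) where
  toFun := toFun
  map_zero' := rfl
  map_add' _ _ := rfl

instance : Module ℂ SmoothPeriodic :=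
  toFun_injective.module ℂ coeHom (fun _ _ => rfl)

theorem continuous (g : SmoothPeriodic) : Continuous g.toFun := by
  have h : Continuous (fun x : ℝ => g (x : UnitAddCircle)) := g.smooth.continuous
  exact (QuotientAddGroup.isQuotientMap_mk (AddSubgroup.zmultiples (1 : ℝ))).continuous_iff.mpr h

/-- The inclusion of `S(𝕋)` in the Banach space of continuous functions (with the sup norm). -/
def toContinuousMap : SmoothPeriodic →ₗ[ℂ] C(UnitAddCircle, ℂ) where
  toFun g := ⟨g, g.continuous⟩
  map_add' _ _ := rfl
  map_smul' _ _ := rfl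

theorem periodic_deriv (g : SmoothPeriodic) :
    Function.Periodic (deriv fun x : ℝ => g (x : UnitAddCircle)) 1 := by
  intro x
  rw [← deriv_comp_add_const]
  congr 1
  funext y
  rw [AddCircle.coe_add_period]

/-- The derivative `d/dx : S(𝕋) → S(𝕋)`. -/
def derivative : SmoothPeriodic →ₗ[ℂ] SmoothPeriodic where
  toFun g :=
    { toFun := g.periodic_deriv.lift
      smooth := (contDiff_infty_iff_deriv.mp g.smooth).2 }
  map_add' g h := by
    ext t
    induction t using QuotientAddGroup.induction_on with
    | H x =>
      exact deriv_add (g.smooth.differentiable (by simp) x) (h.smooth.differentiable (by simp) x)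
  map_smul' c g := by
    ext t
    induction t using QuotientAddGroup.induction_on with
    | H x => exact deriv_const_smul c (g.smooth.differentiable (by simp) x)

/-- The seminorms `g ↦ sup_t |g^{(n)}(t)|`, `n ∈ ℕ`. -/
def seminorms : SeminormFamily ℂ SmoothPeriodic ℕ := fun n =>
  (normSeminorm ℂ C(UnitAddCircle, ℂ)).comp (toContinuousMap ∘ₗ (derivative ^ n))

/-- The usual Fréchet topology of `S(𝕋)`: uniform convergence of all derivatives. -/
instance : TopologicalSpace SmoothPeriodic := seminorms.moduleFilterBasis.topology

theorem withSeminorms : WithSeminorms seminorms := ⟨rfl⟩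

/-- The character `t ↦ exp (2 π i k t)` as an element of `S(𝕋)`. -/
def character (k : ℤ) : SmoothPeriodic where
  toFun := fourier k
  smooth := by
    simp only [fourier_coe_apply]
    exact ((contDiff_const.mul Complex.ofRealCLM.contDiff).div_const _).cexp

end SmoothPeriodic

/-- The space `S'(𝕋)` of periodic generalized functions: the topological dual of `S(𝕋)`. -/
abbrev GeneralizedFunction : Type := SmoothPeriodic →L[ℂ] ℂ

namespace GeneralizedFunction

/-- The Fourier coefficient `f̂_k = ⟨f, exp (-2 π i k ·)⟩`, `k ∈ ℤ`. -/
def coeff (f : GeneralizedFunction) (k : ℤ) : ℂ := f (SmoothPeriodic.character (-k))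

/-- `f ∈ S(𝕋)`: the generalized function `f` is given by integration against
an infinitely smooth periodic function. -/
def IsSmooth (f : GeneralizedFunction) : Prop :=
  ∃ g : SmoothPeriodic, ∀ h : SmoothPeriodic, f h = ∫ t, g t * h t ∂AddCircle.haarAddCircle

end GeneralizedFunction

/-- A smooth dyadic resolution of unity on the line: non-negative Schwartz functions `φ₀` and `φ`
with `Supp φ₀ ⊆ {|x| ≤ 2}`, `Supp φ ⊆ {1/2 ≤ |x| ≤ 2}`, and
`φ₀ + ∑_{j ≥ 1} φ(2⁻ʲ ·) = 1` everywhere. -/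
structure DyadicResolution where
  /-- the low frequency window -/
  φ₀ : 𝓢(ℝ, ℝ)
  /-- the window whose dilates by `2 ^ j`, `j ≥ 1`, cover the higher frequencies -/
  φ : 𝓢(ℝ, ℝ)
  φ₀_nonneg : ∀ x, 0 ≤ φ₀ x
  φ_nonneg : ∀ x, 0 ≤ φ x
  φ₀_supp : tsupport φ₀ ⊆ {x : ℝ | |x| ≤ 2}
  φ_supp : tsupport φ ⊆ {x : ℝ | 1 / 2 ≤ |x| ∧ |x| ≤ 2}
  hasSum_one : ∀ x : ℝ, HasSum (fun j : ℕ => if j = 0 then φ₀ x else φ (x / 2 ^ j)) 1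

namespace DyadicResolution

/-- The `j`-th window: `φ_0 = φ₀`, and `φ_j = φ(2⁻ʲ ·)` for `j ≥ 1`. -/
def window (Φ : DyadicResolution) (j : ℕ) (x : ℝ) : ℝ :=
  if j = 0 then Φ.φ₀ x else Φ.φ (x / 2 ^ j)

/-- Dyadic resolutions of unity exist. -/
theorem nonempty : Nonempty DyadicResolution := by
  let b : ContDiffBump (0 : ℝ) := ⟨1, 2, one_pos, one_lt_two⟩
  have b_one : ∀ x : ℝ, |x| ≤ 1 → b x = 1 := fun x hx =>
    b.one_of_mem_closedBall (by simpa [b] using hx)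
  have b_zero : ∀ x : ℝ, 2 ≤ |x| → b x = 0 := fun x hx =>
    b.zero_of_le_dist (by simpa [b] using hx)
  let c : ℝ → ℝ := fun x => b x - b (2 * x)
  have c_zero : ∀ x : ℝ, x ∉ {x : ℝ | 1 / 2 ≤ |x| ∧ |x| ≤ 2} → c x = 0 := by
    intro x hx
    have h2 : |2 * x| = 2 * |x| := by rw [abs_mul]; norm_num
    rcases lt_or_ge |x| (1 / 2) with h | h
    · simp [c, b_one x (by linarith), b_one (2 * x) (by linarith)]
    · have h' : 2 < |x| := by
        by_contra h3
        exact hx ⟨h, not_lt.mp h3⟩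
      simp [c, b_zero x (by linarith), b_zero (2 * x) (by linarith)]
  have c_supp : tsupport c ⊆ {x : ℝ | 1 / 2 ≤ |x| ∧ |x| ≤ 2} := by
    refine closure_minimal (fun x hx => ?_) ?_
    · by_contra h
      exact hx (c_zero x h)
    · exact (isClosed_le continuous_const continuous_abs).inter
        (isClosed_le continuous_abs continuous_const)
  have c_compact : HasCompactSupport c :=
    HasCompactSupport.intro (isCompact_closedBall (0 : ℝ) 2) fun x hx =>
      c_zero x fun h => hx (by simpa using h.2)
  have c_smooth : ContDiff ℝ ∞ c :=
    b.contDiff.sub (b.contDiff.comp (contDiff_const.mul contDiff_id))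
  refine ⟨⟨b.hasCompactSupport.toSchwartzMap b.contDiff, c_compact.toSchwartzMap c_smooth,
    fun x => b.nonneg, fun x => ?_, ?_, c_supp, fun x => ?_⟩⟩
  · change 0 ≤ b x - b (2 * x)
    rcases le_or_gt |x| 1 with h | h
    · rw [b_one x h]
      exact sub_nonneg.mpr b.le_one
    · rw [b_zero (2 * x) (by rw [abs_mul]; norm_num; linarith), sub_zero]
      exact b.nonneg
  · intro x hx
    have hx' : x ∈ tsupport b := hx
    rw [b.tsupport_eq] at hx'
    simpa [b] using hx'
  · change HasSum (fun j : ℕ => if j = 0 then b x else b (x / 2 ^ j) - b (2 * (x / 2 ^ j))) 1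
    obtain ⟨N, hN⟩ := pow_unbounded_of_one_lt |x| (one_lt_two : (1 : ℝ) < 2)
    have small : ∀ j : ℕ, N ≤ j → b (x / 2 ^ j) = 1 := by
      intro j hj
      refine b_one _ ?_
      rw [abs_div, abs_of_pos (by positivity : (0 : ℝ) < 2 ^ j), div_le_one (by positivity)]
      exact hN.le.trans (pow_le_pow_right₀ one_le_two hj)
    have step : ∀ j : ℕ, 2 * (x / 2 ^ (j + 1)) = x / 2 ^ j := by
      intro j
      rw [pow_succ]
      field_simp
    have partial_sum : ∀ n : ℕ, ∑ j ∈ Finset.range (n + 1),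
        (if j = 0 then b x else b (x / 2 ^ j) - b (2 * (x / 2 ^ j))) = b (x / 2 ^ n) := by
      intro n
      induction n with
      | zero => simp
      | succ n ih =>
        rw [Finset.sum_range_succ, ih, if_neg (Nat.succ_ne_zero n), step]
        ring
    have key := hasSum_sum_of_ne_finset_zero
      (f := fun j : ℕ => if j = 0 then b x else b (x / 2 ^ j) - b (2 * (x / 2 ^ j)))
      (s := Finset.range (N + 1)) (L := SummationFilter.unconditional ℕ) (fun j hj => by
        obtain ⟨m, rfl⟩ : ∃ m, j = m + 1 := ⟨j - 1, by simp at hj; omega⟩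
        simp only [Finset.mem_range, not_lt] at hj
        rw [if_neg (Nat.succ_ne_zero m), step, small _ (by omega), small _ (by omega), sub_self])
    rwa [partial_sum, small N le_rfl] at key

/-- The dyadic block `t ↦ ∑_{k ∈ ℤ} φ_j(k) f̂_k exp (2 π i k t)` (a finite sum). -/
def block (Φ : DyadicResolution) (f : GeneralizedFunction) (j : ℕ) (t : UnitAddCircle) : ℂ :=
  ∑' k : ℤ, (Φ.window j (k : ℝ) : ℂ) * f.coeff k * fourier k t

/-- The Besov (quasi-)norm `‖f‖_{B^s_{p,q}}`, with values in `[0, ∞]`, for `0 < p, q ≤ ∞`. -/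
def besovNorm (Φ : DyadicResolution) (s : ℝ) (p q : ℝ≥0∞) (f : GeneralizedFunction) : ℝ≥0∞ :=
  if q = ⊤ then
    ⨆ j : ℕ, (2 : ℝ≥0∞) ^ (j * s : ℝ) * eLpNorm (Φ.block f j) p AddCircle.haarAddCircle
  else
    (∑' j : ℕ, (2 : ℝ≥0∞) ^ (j * s * q.toReal : ℝ) *
      eLpNorm (Φ.block f j) p AddCircle.haarAddCircle ^ q.toReal) ^ (1 / q.toReal)

/-- The periodic Besov space `B^s_{p,q}(𝕋)` as a subset of `S'(𝕋)`. -/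
def besovSpace (Φ : DyadicResolution) (s : ℝ) (p q : ℝ≥0∞) : Set GeneralizedFunction :=
  {f | Φ.besovNorm s p q f < ⊤}

/-- The `(p,q)`-critical smoothness
`s_f(p,q) = sup {s ∈ ℝ : f ∈ B^s_{p,q}(𝕋)}`, as an extended real number. -/
def criticalSmoothnessPQ (Φ : DyadicResolution) (f : GeneralizedFunction) (p q : ℝ≥0∞) : EReal :=
  sSup ((fun s : ℝ => (s : EReal)) '' {s : ℝ | f ∈ Φ.besovSpace s p q})

theorem mem_besovSpace_top (Φ : DyadicResolution) {f : GeneralizedFunction} {s : ℝ}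
    {p q : ℝ≥0∞} (hq : 0 < q) (hf : f ∈ Φ.besovSpace s p q) : f ∈ Φ.besovSpace s p ⊤ := by
  rcases eq_or_ne q ⊤ with rfl | hq'
  · exact hf
  have hr : 0 < q.toReal := ENNReal.toReal_pos hq.ne' hq'
  simp only [besovSpace, besovNorm, Set.mem_ofPred_eq, if_neg hq', if_true] at hf ⊢
  refine lt_of_le_of_lt (iSup_le fun j => ?_) hf
  rw [one_div, ENNReal.le_rpow_inv_iff hr, ENNReal.mul_rpow_of_nonneg _ _ hr.le,
    ← ENNReal.rpow_mul]
  exact ENNReal.le_tsum (f := fun j : ℕ => (2 : ℝ≥0∞) ^ (j * s * q.toReal : ℝ) *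
      eLpNorm (Φ.block f j) p AddCircle.haarAddCircle ^ q.toReal) j

theorem mem_besovSpace_of_top (Φ : DyadicResolution) {f : GeneralizedFunction} {s r : ℝ}
    {p q : ℝ≥0∞} (hq : 0 < q) (hr : r < s) (hf : f ∈ Φ.besovSpace s p ⊤) :
    f ∈ Φ.besovSpace r p q := by
  simp only [besovSpace, besovNorm, Set.mem_ofPred_eq, if_true] at hf
  set C : ℝ≥0∞ := ⨆ j : ℕ, (2 : ℝ≥0∞) ^ (j * s : ℝ) *
    eLpNorm (Φ.block f j) p AddCircle.haarAddCircle with hC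
  have two_ne : (2 : ℝ≥0∞) ≠ 0 := two_ne_zero
  have bound : ∀ j : ℕ, (2 : ℝ≥0∞) ^ (j * r : ℝ) *
      eLpNorm (Φ.block f j) p AddCircle.haarAddCircle ≤ (2 : ℝ≥0∞) ^ (j * (r - s) : ℝ) * C := by
    intro j
    have h : (j * r : ℝ) = j * (r - s) + j * s := by ring
    rw [h, ENNReal.rpow_add _ _ two_ne (by simp), mul_assoc]
    gcongr
    exact le_iSup (fun j : ℕ => (2 : ℝ≥0∞) ^ (j * s : ℝ) *
      eLpNorm (Φ.block f j) p AddCircle.haarAddCircle) j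
  have base_lt : (2 : ℝ≥0∞) ^ (r - s) < 1 :=
    ENNReal.rpow_lt_one_of_one_lt_of_neg (by norm_num) (by linarith)
  simp only [besovSpace, besovNorm, Set.mem_ofPred_eq]
  split_ifs with hq'
  · refine lt_of_le_of_lt (iSup_le fun j => (bound j).trans ?_) hf
    refine mul_le_of_le_one_left' ?_
    rw [mul_comm, ENNReal.rpow_mul]
    exact ENNReal.rpow_le_one base_lt.le (by positivity)
  · have ht : 0 < q.toReal := ENNReal.toReal_pos hq.ne' hq'
    refine ENNReal.rpow_lt_top_of_nonneg (by positivity) (ne_of_lt ?_)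
    have bound' : ∀ j : ℕ, (2 : ℝ≥0∞) ^ (j * r * q.toReal : ℝ) *
        eLpNorm (Φ.block f j) p AddCircle.haarAddCircle ^ q.toReal ≤
        (((2 : ℝ≥0∞) ^ (r - s)) ^ q.toReal) ^ j * C ^ q.toReal := by
      intro j
      have h := ENNReal.rpow_le_rpow (bound j) ht.le
      rw [ENNReal.mul_rpow_of_nonneg _ _ ht.le, ENNReal.mul_rpow_of_nonneg _ _ ht.le,
        ← ENNReal.rpow_mul, ← ENNReal.rpow_mul] at h
      rw [← ENNReal.rpow_mul, ← ENNReal.rpow_natCast, ← ENNReal.rpow_mul]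
      convert h using 3
      ring
    refine lt_of_le_of_lt (ENNReal.tsum_le_tsum bound') ?_
    rw [ENNReal.tsum_mul_right, ENNReal.tsum_geometric]
    refine ENNReal.mul_lt_top (ENNReal.inv_lt_top.mpr (tsub_pos_of_lt ?_))
      (ENNReal.rpow_lt_top_of_nonneg ht.le hf.ne)
    exact ENNReal.rpow_lt_one base_lt ht

theorem criticalSmoothnessPQ_eq (Φ : DyadicResolution) (f : GeneralizedFunction)
    {p q₁ q₂ : ℝ≥0∞} (h₁ : 0 < q₁) (h₂ : 0 < q₂) :
    Φ.criticalSmoothnessPQ f p q₁ = Φ.criticalSmoothnessPQ f p q₂ := by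
  have key : ∀ {q q' : ℝ≥0∞}, 0 < q → 0 < q' →
      Φ.criticalSmoothnessPQ f p q ≤ Φ.criticalSmoothnessPQ f p q' := by
    intro q q' hq hq'
    refine sSup_le ?_
    rintro _ ⟨s, hs, rfl⟩
    refine EReal.ge_of_forall_gt_iff_ge.mp fun r hr => ?_
    refine le_sSup ⟨r, ?_, rfl⟩
    exact Φ.mem_besovSpace_of_top hq' (EReal.coe_lt_coe_iff.mp hr) (Φ.mem_besovSpace_top hq hs)
  exact le_antisymm (key h₁ h₂) (key h₂ h₁)

/-- The critical smoothness `s_f(p)`: the common value of `s_f(p,q)`, `0 < q ≤ ∞`, taken here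
at `q = p`; see `criticalSmoothnessPQ_eq` for the independence of `q`. -/
def criticalSmoothness (Φ : DyadicResolution) (f : GeneralizedFunction) (p : ℝ≥0∞) : EReal :=
  Φ.criticalSmoothnessPQ f p p

end DyadicResolution
end PeriodicBesov
end

/-! Both smoothness of `f` and infinite critical smoothness at any single `p` are equivalent to
rapid decay of the Fourier coefficients, a condition in which `p` does not appear.

Smooth functions have rapidly decreasing coefficients by integration by parts. Conversely, a series
with such coefficients defines a smooth function, which represents `f` because the Fourier series of
a test function converges in S(𝕋) (`isSmooth_of_rapidDecay_coeff`).

Rapid decay makes the dyadic blocks smaller than every power of `2 ^ (-j)` in sup norm, hence in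
every L_p (`criticalSmoothness_eq_top_of_rapidDecay`). In the other direction, a block has O(2^j)
frequencies, so Nikolskii's inequality (`enorm_coeff_le_eLpNorm`) bounds its coefficients by its L_p
quasi-norm at the cost of a fixed power of `2 ^ j`. This loss is harmless since `s` is arbitrary.
Summing over the resolution of unity recovers the coefficients of `f`. -/

namespace PeriodicBesov

open AddCircle (haarAddCircle)

/-! ### Rapidly decreasing sequences -/

/-- Rapid decay of a sequence indexed by `ℤ`: it is summable against every power of `|k|`. -/
def RapidDecay (a : ℤ → ℂ) : Prop :=
  ∀ m : ℕ, Summable fun k : ℤ => |(k : ℝ)| ^ m * ‖a k‖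

theorem rapidDecay_of_bounded {a : ℤ → ℂ}
    (h : ∀ m : ℕ, ∃ C : ℝ, ∀ k : ℤ, |(k : ℝ)| ^ m * ‖a k‖ ≤ C) : RapidDecay a := by
  intro m
  obtain ⟨C, hC⟩ := h (m + 2)
  have hs : Summable fun k : ℤ => C * (1 / (k : ℝ) ^ 2) :=
    (Real.summable_one_div_int_pow.mpr one_lt_two).mul_left C
  -- At `k = 0` the majorant is `C * (1 / 0) = 0`, so the comparison is made off `{0}` only.
  refine hs.of_norm_bounded_eventually ?_
  refine (Set.finite_singleton (0 : ℤ)).subset fun k hk => ?_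
  by_contra hk0
  refine hk ?_
  have hpos : (0 : ℝ) < (k : ℝ) ^ 2 := by
    have : (k : ℝ) ≠ 0 := Int.cast_ne_zero.mpr hk0
    positivity
  change ‖|(k : ℝ)| ^ m * ‖a k‖‖ ≤ C * (1 / (k : ℝ) ^ 2)
  rw [Real.norm_of_nonneg (by positivity), mul_one_div, le_div_iff₀ hpos]
  calc |(k : ℝ)| ^ m * ‖a k‖ * (k : ℝ) ^ 2 = |(k : ℝ)| ^ (m + 2) * ‖a k‖ := by
        rw [← sq_abs, pow_add]; ring
    _ ≤ C := hC k

theorem RapidDecay.summable_norm {a : ℤ → ℂ} (ha : RapidDecay a) : Summable fun k => ‖a k‖ := by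
  simpa using ha 0

theorem norm_fourier_apply (k : ℤ) (t : UnitAddCircle) : ‖fourier k t‖ = 1 := by
  rw [fourier_apply]; exact Circle.norm_coe _

/-! ### Fourier series of smooth periodic functions -/

namespace SmoothPeriodic

theorem hasDerivAt (g : SmoothPeriodic) (x : ℝ) :
    HasDerivAt (fun y : ℝ => g (y : UnitAddCircle)) (derivative g (x : UnitAddCircle)) x :=
  (g.smooth.differentiable (by simp) x).hasDerivAt

/-- Integration by parts over one period; the boundary terms cancel by periodicity. -/
theorem fourierCoeff_derivative (g : SmoothPeriodic) (k : ℤ) :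
    fourierCoeff (derivative g) k = 2 * Real.pi * Complex.I * k * fourierCoeff g k := by
  have hu : ∀ x : ℝ, HasDerivAt (fun y : ℝ => fourier (-k) (y : UnitAddCircle))
      (-(2 * Real.pi * Complex.I * k) * fourier (-k) (x : UnitAddCircle)) x := fun x => by
    convert hasDerivAt_fourier 1 (-k) x using 1
    push_cast
    ring
  have hcont : ∀ h : SmoothPeriodic, Continuous fun x : ℝ => h (x : UnitAddCircle) :=
    fun h => h.smooth.continuous
  have hcont' : Continuous fun x : ℝ => fourier (-k) (x : UnitAddCircle) :=
    continuous_iff_continuousAt.mpr fun x => (hu x).continuousAt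
  have key := intervalIntegral.integral_deriv_mul_eq_sub (a := 0) (b := 1)
    (fun x _ => hu x) (fun x _ => g.hasDerivAt x)
    ((continuous_const.mul hcont').intervalIntegrable _ _)
    ((hcont (derivative g)).intervalIntegrable _ _)
  have hi₁ : IntervalIntegrable (fun x : ℝ => -(2 * Real.pi * Complex.I * k) *
      fourier (-k) (x : UnitAddCircle) * g (x : UnitAddCircle)) volume 0 1 :=
    ((continuous_const.mul hcont').mul (hcont g)).intervalIntegrable _ _
  have hi₂ : IntervalIntegrable (fun x : ℝ => fourier (-k) (x : UnitAddCircle) *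
      derivative g (x : UnitAddCircle)) volume 0 1 :=
    (hcont'.mul (hcont _)).intervalIntegrable _ _
  rw [intervalIntegral.integral_add hi₁ hi₂] at key
  have h1 : ((1 : ℝ) : UnitAddCircle) = ((0 : ℝ) : UnitAddCircle) := by
    simp
  rw [h1, sub_self] at key
  simp only [mul_assoc (-(2 * Real.pi * Complex.I * k))] at key
  rw [intervalIntegral.integral_const_mul] at key
  rw [fourierCoeff_eq_intervalIntegral _ _ 0, fourierCoeff_eq_intervalIntegral _ _ 0]
  simp only [zero_add, div_one, one_smul, smul_eq_mul]
  linear_combination key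

theorem fourierCoeff_derivative_pow (g : SmoothPeriodic) (n : ℕ) (k : ℤ) :
    fourierCoeff ((derivative ^ n) g) k
      = (2 * Real.pi * Complex.I * k) ^ n * fourierCoeff g k := by
  induction n with
  | zero => simp
  | succ n ih => rw [pow_succ', Module.End.mul_apply, fourierCoeff_derivative, ih]; ring

theorem norm_fourierCoeff_le (g : C(UnitAddCircle, ℂ)) (k : ℤ) : ‖fourierCoeff g k‖ ≤ ‖g‖ := by
  have h := norm_integral_le_of_norm_le_const (μ := (haarAddCircle : Measure UnitAddCircle))
    (f := fun t => fourier (-k) t • g t) (C := ‖g‖) (Filter.Eventually.of_forall fun t => by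
      rw [norm_smul, norm_fourier_apply, one_mul]
      exact g.norm_coe_le_norm t)
  simpa [fourierCoeff] using h

/-- The sup norm of the `m`-th derivative bounds its coefficients, which carry the factor `|2πk| ^ m
≥ |k| ^ m`. -/
theorem rapidDecay_fourierCoeff (g : SmoothPeriodic) : RapidDecay (fourierCoeff g) := by
  refine rapidDecay_of_bounded fun m => ⟨‖toContinuousMap ((derivative ^ m) g)‖, fun k => ?_⟩
  refine le_trans ?_ (norm_fourierCoeff_le (toContinuousMap ((derivative ^ m) g)) k)
  change _ ≤ ‖fourierCoeff ((derivative ^ m) g) k‖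
  rw [fourierCoeff_derivative_pow, norm_mul, norm_pow]
  refine mul_le_mul_of_nonneg_right (pow_le_pow_left₀ (abs_nonneg _) ?_ _) (norm_nonneg _)
  simp only [norm_mul, Complex.norm_I, Complex.norm_real, Complex.norm_intCast, RCLike.norm_ofNat,
    Real.norm_eq_abs, abs_of_pos Real.pi_pos]
  nlinarith [abs_nonneg (k : ℝ), Real.pi_gt_three]

theorem derivative_character (k : ℤ) :
    derivative (character k) = (2 * Real.pi * Complex.I * k : ℂ) • character k := by
  ext t
  induction t using QuotientAddGroup.induction_on with
  | H x =>
    have h := hasDerivAt_fourier 1 k x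
    simp only [Complex.ofReal_one, div_one] at h
    exact h.deriv

theorem derivative_pow_character (n : ℕ) (k : ℤ) :
    (derivative ^ n) (character k) = ((2 * Real.pi * Complex.I * k : ℂ) ^ n) • character k := by
  induction n with
  | zero => simp
  | succ n ih =>
    rw [pow_succ', Module.End.mul_apply, ih, map_smul, derivative_character, smul_smul, pow_succ]

/-- The Fourier series of a smooth periodic function converges in `S(𝕋)`. -/
theorem hasSum_fourierCoeff_smul_character (h : SmoothPeriodic) :
    HasSum (fun k : ℤ => fourierCoeff h k • character k) h := by
  -- One seminorm at a time: the `n`-th derivative of the series is the Fourier series of the `n`-th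
  -- derivative, whose coefficients are summable, so it converges uniformly.
  refine (withSeminorms.tendsto_nhds _ _).mpr fun n ε hε => ?_
  have hs : HasSum (fun k : ℤ => toContinuousMap ((derivative ^ n) (fourierCoeff h k • character k)))
      (toContinuousMap ((derivative ^ n) h)) := by
    have h1 := hasSum_fourier_series_of_summable (f := toContinuousMap ((derivative ^ n) h))
      (rapidDecay_fourierCoeff ((derivative ^ n) h)).summable_norm.of_norm
    refine h1.congr_fun ?_
    intro k
    change _ = fourierCoeff ((derivative ^ n) h) k • fourier k
    rw [fourierCoeff_derivative_pow, map_smul, derivative_pow_character, smul_smul, map_smul,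
      mul_comm]
    rfl
  have h2 := (Metric.tendsto_nhds.mp hs) ε hε
  filter_upwards [h2] with s hs'
  rw [dist_eq_norm] at hs'
  change ‖toContinuousMap ((derivative ^ n) _)‖ < ε
  rwa [map_sub, map_sub, map_sum, map_sum]

theorem iteratedDeriv_character (n : ℕ) (k : ℤ) :
    iteratedDeriv n (fun x : ℝ => fourier k (x : UnitAddCircle))
      = fun x : ℝ => (2 * Real.pi * Complex.I * k : ℂ) ^ n * fourier k (x : UnitAddCircle) := by
  induction n with
  | zero => simp
  | succ n ih =>
    rw [iteratedDeriv_succ, ih]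
    funext x
    have h := (hasDerivAt_fourier 1 k x).const_mul ((2 * Real.pi * Complex.I * k : ℂ) ^ n)
    simp only [Complex.ofReal_one, div_one] at h
    rw [h.deriv]
    ring

/-- The smooth periodic function with rapidly decreasing Fourier coefficients `a`. -/
noncomputable def ofRapidDecay (a : ℤ → ℂ) (ha : RapidDecay a) : SmoothPeriodic where
  toFun t := ∑' k : ℤ, a k * fourier k t
  smooth := by
    refine contDiff_tsum (N := ⊤)
      (f := fun (k : ℤ) (x : ℝ) => a k * fourier k (x : UnitAddCircle)) (v := fun n k => (2 * Real.pi) ^ n * (|(k : ℝ)| ^ n * ‖a k‖))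
      (fun k => contDiff_const.mul (character k).smooth) (fun n _ => (ha n).mul_left _) ?_
    intro n k x _
    rw [norm_iteratedFDeriv_eq_norm_iteratedDeriv, iteratedDeriv_const_mul_field,
      iteratedDeriv_character]
    simp only [norm_mul, norm_pow, norm_fourier_apply, Complex.norm_I, Complex.norm_real,
      Complex.norm_intCast, RCLike.norm_ofNat, Real.norm_eq_abs, abs_of_pos Real.pi_pos]
    exact le_of_eq (by ring)

end SmoothPeriodic

/-! ### Smoothness of a generalized function and decay of its coefficients -/

namespace GeneralizedFunction

theorem IsSmooth.rapidDecay_coeff {f : GeneralizedFunction} (hf : f.IsSmooth) :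
    RapidDecay f.coeff := by
  obtain ⟨g, hg⟩ := hf
  have : f.coeff = fourierCoeff g := by
    funext k
    rw [coeff, hg, fourierCoeff]
    exact integral_congr_ae (Filter.Eventually.of_forall fun t => mul_comm _ _)
  rw [this]
  exact g.rapidDecay_fourierCoeff

theorem isSmooth_of_rapidDecay_coeff {f : GeneralizedFunction} (hf : RapidDecay f.coeff) :
    f.IsSmooth := by
  refine ⟨SmoothPeriodic.ofRapidDecay f.coeff hf, fun h => ?_⟩
  have h1 := f.hasSum h.hasSum_fourierCoeff_smul_character
  have h2 : HasSum (fun k : ℤ => ∫ t, f.coeff k * fourier k t * h t ∂haarAddCircle)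
      (∫ t, ∑' k : ℤ, f.coeff k * fourier k t * h t ∂haarAddCircle) := by
    have hcont : Continuous h.toFun := h.continuous
    have hF : ∀ k : ℤ, Continuous fun t : UnitAddCircle => f.coeff k * fourier k t * h t := by
      intro k; fun_prop
    refine hasSum_integral_of_summable_integral_norm
      (fun k => (hF k).integrable_of_hasCompactSupport (HasCompactSupport.of_compactSpace _)) ?_
    simp only [norm_mul, norm_fourier_apply, mul_one, integral_const_mul]
    exact hf.summable_norm.mul_right _
  -- `f.coeff k` tests `f` on the character of index `-k`, so the two expansions match after `k ↦
  -- -k`.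
  have h3 := (Equiv.neg ℤ).hasSum_iff.mpr h2
  have h4 : ∀ k : ℤ, ∫ t, f.coeff (-k) * fourier (-k) t * h t ∂haarAddCircle
      = f (fourierCoeff h k • SmoothPeriodic.character k) := by
    intro k
    simp only [mul_assoc]
    rw [integral_const_mul, map_smul, coeff, neg_neg, smul_eq_mul, mul_comm]
    rfl
  have h5 : HasSum (fun k : ℤ => f (fourierCoeff h k • SmoothPeriodic.character k))
      (∫ t, ∑' k : ℤ, f.coeff k * fourier k t * h t ∂haarAddCircle) :=
    h3.congr_fun fun k => (h4 k).symm
  rw [h1.unique h5]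
  refine integral_congr_ae (Filter.Eventually.of_forall fun t => ?_)
  exact tsum_mul_right

end GeneralizedFunction

/-! ### Nikolskii's inequality for exponents at most one -/

theorem lintegral_enorm_le_of_le {g : UnitAddCircle → ℂ} {M : ℝ≥0∞} {r : ℝ} (hr : 0 < r)
    (hr1 : r ≤ 1) (hM : ∀ t, ‖g t‖ₑ ≤ M) (hM' : M ≠ ⊤) :
    ∫⁻ t, ‖g t‖ₑ ∂haarAddCircle ≤ M ^ (1 - r) * ∫⁻ t, ‖g t‖ₑ ^ r ∂haarAddCircle := by
  rw [← lintegral_const_mul' _ _ (ENNReal.rpow_ne_top_of_nonneg (by linarith) hM')]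
  refine lintegral_mono fun t => ?_
  calc ‖g t‖ₑ = ‖g t‖ₑ ^ (1 - r) * ‖g t‖ₑ ^ r := by
        rw [← ENNReal.rpow_add_of_nonneg _ _ (by linarith) hr.le, sub_add_cancel,
          ENNReal.rpow_one]
    _ ≤ _ := by gcongr; exact hM t

/-- If the sup norm is controlled by the `L₁` norm then it is controlled by the `L_r` norm,
`0 < r ≤ 1`. -/
theorem sup_le_of_sup_le_lintegral {g : UnitAddCircle → ℂ} {M K : ℝ≥0∞} {r : ℝ} (hr : 0 < r)
    (hr1 : r ≤ 1) (hM : ∀ t, ‖g t‖ₑ ≤ M) (hM' : M ≠ ⊤)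
    (hK : M ≤ K * ∫⁻ t, ‖g t‖ₑ ∂haarAddCircle) :
    M ≤ K ^ (1 / r) * eLpNorm g (ENNReal.ofReal r) haarAddCircle := by
  rcases eq_or_ne M 0 with rfl | hM0
  · exact zero_le
  have hMr0 : M ^ (1 - r) ≠ 0 := (ENNReal.rpow_pos hM0.bot_lt hM').ne'
  have hMr : M ^ (1 - r) ≠ ⊤ := ENNReal.rpow_ne_top_of_nonneg (by linarith) hM'
  have h : M ^ r ≤ K * ∫⁻ t, ‖g t‖ₑ ^ r ∂haarAddCircle := by
    -- Absorption: `M ^ (1 - r)` occurs on both sides and cancels because `M` is finite and nonzero.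
    refine (ENNReal.mul_le_mul_iff_right hMr0 hMr).mp ?_
    calc M ^ (1 - r) * M ^ r = M := by
          rw [← ENNReal.rpow_add_of_nonneg _ _ (by linarith) hr.le, sub_add_cancel,
            ENNReal.rpow_one]
      _ ≤ K * ∫⁻ t, ‖g t‖ₑ ∂haarAddCircle := hK
      _ ≤ K * (M ^ (1 - r) * ∫⁻ t, ‖g t‖ₑ ^ r ∂haarAddCircle) := by
          gcongr; exact lintegral_enorm_le_of_le hr hr1 hM hM'
      _ = _ := by ring
  rw [eLpNorm_eq_lintegral_rpow_enorm_toReal (by simpa using hr) ENNReal.ofReal_ne_top,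
    ENNReal.toReal_ofReal hr.le, ← ENNReal.mul_rpow_of_nonneg _ _ (by positivity), one_div,
    ENNReal.le_rpow_inv_iff hr]
  exact h

/-- Nikolskii's inequality for the trigonometric polynomials with frequencies in `s`. -/
theorem enorm_coeff_le_eLpNorm (s : Finset ℤ) (c : ℤ → ℂ) {r : ℝ} (hr : 0 < r) (hr1 : r ≤ 1)
    (k : ℤ) (hk : k ∈ s) :
    ‖c k‖ₑ ≤ (s.card : ℝ≥0∞) ^ (1 / r) *
      eLpNorm (fun t : UnitAddCircle => ∑ l ∈ s, c l * fourier l t) (ENNReal.ofReal r)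
        haarAddCircle := by
  set g : UnitAddCircle → ℂ := fun t => ∑ l ∈ s, c l * fourier l t with hg
  have hn : ∀ (l : ℤ) (t : UnitAddCircle), ‖fourier l t‖ₑ = 1 := by
    intro l t
    rw [← ofReal_norm, fourier_apply, Circle.norm_coe, ENNReal.ofReal_one]
  have hcoef : ∀ l ∈ s, ‖c l‖ₑ ≤ ∫⁻ t, ‖g t‖ₑ ∂haarAddCircle := by
    intro l hl
    have h1 : fourierCoeff g l = c l := by
      have hsum : g = ∑ m ∈ s, fun t : UnitAddCircle => c m * fourier m t := by
        funext t; simp only [hg, Finset.sum_apply]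
      rw [hsum, fourierCoeff.sum s (fun m t => c m * fourier m t) (fun m _ =>
        Continuous.integrable_of_hasCompactSupport (by fun_prop)
          (HasCompactSupport.of_compactSpace _))]
      simp only [Finset.sum_apply, fourierCoeff.const_mul, fourierCoeff_fourier]
      simp [Pi.single_apply, hl]
    rw [← h1, fourierCoeff]
    refine (enorm_integral_le_lintegral_enorm _).trans_eq ?_
    simp only [enorm_smul, hn, one_mul]
  -- The ℓ¹ norm of the coefficients stands in for the sup norm: it dominates `g` pointwise, is
  -- finite, and is at most `s.card` times the L₁ norm.
  set M : ℝ≥0∞ := ∑ l ∈ s, ‖c l‖ₑ with hMdef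
  have hM : ∀ t, ‖g t‖ₑ ≤ M := fun t => by
    refine (enorm_sum_le _ _).trans_eq ?_
    simp only [enorm_mul, hn, mul_one, hMdef]
  have hM' : M ≠ ⊤ := ENNReal.sum_ne_top.mpr fun l _ => enorm_ne_top
  have hK : M ≤ s.card * ∫⁻ t, ‖g t‖ₑ ∂haarAddCircle := by
    rw [← nsmul_eq_mul]
    exact Finset.sum_le_card_nsmul _ _ _ hcoef
  exact (Finset.single_le_sum (f := fun l => ‖c l‖ₑ) (fun _ _ => zero_le) hk).trans
    (sup_le_of_sup_le_lintegral hr hr1 hM hM' hK)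


/-! ### Windows, blocks and infinite critical smoothness -/

namespace DyadicResolution

variable (Φ : DyadicResolution)

theorem window_nonneg (j : ℕ) (x : ℝ) : 0 ≤ Φ.window j x := by
  unfold window
  split_ifs
  · exact Φ.φ₀_nonneg x
  · exact Φ.φ_nonneg _

theorem hasSum_window (x : ℝ) : HasSum (fun j => Φ.window j x) 1 := Φ.hasSum_one x

theorem window_le_one (j : ℕ) (x : ℝ) : Φ.window j x ≤ 1 :=
  le_hasSum (Φ.hasSum_window x) j fun i _ => Φ.window_nonneg i x

theorem abs_le_of_window_ne_zero {j : ℕ} {x : ℝ} (h : Φ.window j x ≠ 0) : |x| ≤ 2 ^ (j + 1) := by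
  unfold window at h
  split_ifs at h with hj
  · subst hj
    simpa using Φ.φ₀_supp (subset_tsupport _ h)
  · have h1 := (Φ.φ_supp (subset_tsupport _ h)).2
    rwa [abs_div, abs_of_pos (by positivity : (0 : ℝ) < 2 ^ j), div_le_iff₀ (by positivity),
      ← pow_succ'] at h1

theorem le_abs_of_window_ne_zero {j : ℕ} (hj : j ≠ 0) {x : ℝ} (h : Φ.window j x ≠ 0) :
    2 ^ j ≤ 2 * |x| := by
  unfold window at h
  rw [if_neg hj] at h
  have h1 := (Φ.φ_supp (subset_tsupport _ h)).1
  rw [abs_div, abs_of_pos (by positivity : (0 : ℝ) < 2 ^ j), le_div_iff₀ (by positivity)] at h1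
  linarith

theorem mem_Icc_of_window_ne_zero {j : ℕ} {k : ℤ} (h : Φ.window j k ≠ 0) :
    k ∈ Finset.Icc (-2 ^ (j + 1) : ℤ) (2 ^ (j + 1)) := by
  have h1 := Φ.abs_le_of_window_ne_zero h
  rw [Finset.mem_Icc, ← abs_le]
  exact_mod_cast h1

theorem block_eq_sum (f : GeneralizedFunction) (j : ℕ) :
    Φ.block f j = fun t => ∑ k ∈ Finset.Icc (-2 ^ (j + 1) : ℤ) (2 ^ (j + 1)),
      ((Φ.window j k : ℂ) * f.coeff k) * fourier k t := by
  funext t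
  refine tsum_eq_sum fun k hk => ?_
  have : Φ.window j k = 0 := by
    by_contra h
    exact hk (Φ.mem_Icc_of_window_ne_zero h)
  simp [this]

theorem continuous_block (f : GeneralizedFunction) (j : ℕ) : Continuous (Φ.block f j) := by
  rw [block_eq_sum]
  fun_prop

/-- Besov spaces decrease in `s`: membership at some larger `s'` passes to `s` through `q = ∞`. -/
theorem criticalSmoothnessPQ_eq_top_iff {f : GeneralizedFunction} {p q : ℝ≥0∞} (hq : 0 < q) :
    Φ.criticalSmoothnessPQ f p q = ⊤ ↔ ∀ s : ℝ, f ∈ Φ.besovSpace s p q := by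
  constructor
  · intro h s
    have hlt : ((s : ℝ) : EReal) < Φ.criticalSmoothnessPQ f p q := by
      rw [h]; exact EReal.coe_lt_top s
    obtain ⟨_, ⟨s', hs', rfl⟩, hlt'⟩ := lt_sSup_iff.mp hlt
    exact Φ.mem_besovSpace_of_top hq (EReal.coe_lt_coe_iff.mp hlt')
      (Φ.mem_besovSpace_top hq hs')
  · intro h
    rw [criticalSmoothnessPQ, sSup_eq_top]
    intro b hb
    obtain ⟨s, hs, -⟩ := EReal.lt_iff_exists_real_btwn.mp hb
    exact ⟨s, ⟨s, h s, rfl⟩, hs⟩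

theorem criticalSmoothness_eq_top_iff {f : GeneralizedFunction} {p : ℝ≥0∞} (hp : 0 < p) :
    Φ.criticalSmoothness f p = ⊤ ↔ ∀ s : ℝ, f ∈ Φ.besovSpace s p ⊤ := by
  rw [criticalSmoothness, Φ.criticalSmoothnessPQ_eq f hp ENNReal.zero_lt_top,
    criticalSmoothnessPQ_eq_top_iff Φ ENNReal.zero_lt_top]

theorem mem_besovSpace_top_iff {f : GeneralizedFunction} {s : ℝ} {p : ℝ≥0∞} :
    f ∈ Φ.besovSpace s p ⊤ ↔
      ⨆ j : ℕ, (2 : ℝ≥0∞) ^ (j * s : ℝ) * eLpNorm (Φ.block f j) p haarAddCircle < ⊤ := by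
  simp [besovSpace, besovNorm]

/-! ### From rapid decay to infinite critical smoothness -/

/-- For `j ≥ 1`, `2 ^ j ≤ 2 * |k|` on the window, giving the second summand; the first covers `j =
0`. The bound is free of `j` and summable in `k` under rapid decay. -/
theorem pow_mul_norm_window_coeff_le (f : GeneralizedFunction) (j m : ℕ) (k : ℤ) :
    2 ^ (j * m) * ‖(Φ.window j k : ℂ) * f.coeff k‖
      ≤ ‖f.coeff k‖ + 2 ^ m * (|(k : ℝ)| ^ m * ‖f.coeff k‖) := by
  rw [norm_mul, Complex.norm_real, Real.norm_of_nonneg (Φ.window_nonneg _ _)]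
  by_cases hw : Φ.window j k = 0
  · rw [hw]; simp only [zero_mul, mul_zero]; positivity
  have h1 : Φ.window j k * ‖f.coeff k‖ ≤ ‖f.coeff k‖ :=
    mul_le_of_le_one_left (norm_nonneg _) (Φ.window_le_one _ _)
  rcases eq_or_ne j 0 with rfl | hj
  · simp only [zero_mul, pow_zero, one_mul]
    exact h1.trans (le_add_of_nonneg_right (by positivity))
  · have h2 := pow_le_pow_left₀ (by positivity) (Φ.le_abs_of_window_ne_zero hj hw) m
    rw [← pow_mul, mul_pow] at h2
    calc 2 ^ (j * m) * (Φ.window j k * ‖f.coeff k‖)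
        ≤ 2 ^ m * |(k : ℝ)| ^ m * ‖f.coeff k‖ :=
          mul_le_mul h2 h1 (mul_nonneg (Φ.window_nonneg _ _) (norm_nonneg _)) (by positivity)
      _ ≤ _ := by rw [mul_assoc]; exact le_add_of_nonneg_left (norm_nonneg _)

theorem pow_mul_norm_block_le {f : GeneralizedFunction} (hf : RapidDecay f.coeff) (m : ℕ) :
    ∃ C : ℝ, ∀ (j : ℕ) (t : UnitAddCircle), 2 ^ (j * m) * ‖Φ.block f j t‖ ≤ C := by
  have hs := hf.summable_norm.add ((hf m).mul_left (2 ^ m))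
  refine ⟨∑' k : ℤ, (‖f.coeff k‖ + 2 ^ m * (|(k : ℝ)| ^ m * ‖f.coeff k‖)), fun j t => ?_⟩
  rw [block_eq_sum]
  refine le_trans ?_ (hs.sum_le_tsum (Finset.Icc (-2 ^ (j + 1) : ℤ) (2 ^ (j + 1)))
    fun k _ => by positivity)
  refine (mul_le_mul_of_nonneg_left (norm_sum_le _ _) (by positivity)).trans ?_
  rw [Finset.mul_sum]
  refine Finset.sum_le_sum fun k _ => ?_
  rw [norm_mul, norm_fourier_apply, mul_one]
  exact Φ.pow_mul_norm_window_coeff_le f j m k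

theorem criticalSmoothness_eq_top_of_rapidDecay {f : GeneralizedFunction}
    (hf : RapidDecay f.coeff) {p : ℝ≥0∞} (hp : 0 < p) : Φ.criticalSmoothness f p = ⊤ := by
  rw [criticalSmoothness_eq_top_iff Φ hp]
  intro s
  obtain ⟨m, hm⟩ := exists_nat_ge s
  obtain ⟨C, hC⟩ := Φ.pow_mul_norm_block_le hf m
  rw [mem_besovSpace_top_iff]
  refine lt_of_le_of_lt (iSup_le fun j => ?_) (ENNReal.ofReal_lt_top (r := C))
  have hpos : (0 : ℝ) < 2 ^ (j * m) := by positivity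
  have h1 : eLpNorm (Φ.block f j) p haarAddCircle ≤ ENNReal.ofReal (C / 2 ^ (j * m)) := by
    refine (eLpNorm_le_of_ae_bound (C := C / 2 ^ (j * m))
      (Filter.Eventually.of_forall fun t => ?_)).trans_eq (by simp)
    rw [le_div_iff₀ hpos, mul_comm]
    exact hC j t
  have h2 : (2 : ℝ≥0∞) ^ (j * s : ℝ) ≤ ENNReal.ofReal (2 ^ (j * m)) := by
    rw [ENNReal.ofReal_pow zero_le_two, ENNReal.ofReal_ofNat, ← ENNReal.rpow_natCast]
    refine ENNReal.rpow_le_rpow_of_exponent_le one_le_two ?_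
    push_cast
    gcongr
  calc _ ≤ ENNReal.ofReal (2 ^ (j * m)) * ENNReal.ofReal (C / 2 ^ (j * m)) := mul_le_mul' h2 h1
    _ = ENNReal.ofReal C := by
      rw [← ENNReal.ofReal_mul hpos.le, mul_div_cancel₀ _ hpos.ne']

/-! ### From infinite critical smoothness to rapid decay -/

/-- Membership in all the spaces `B^s_{p,∞}`, `s ∈ ℝ`, controls the coefficients of the blocks. -/
theorem exists_norm_window_coeff_le {f : GeneralizedFunction} {p : ℝ≥0∞} (hp : 0 < p)
    (hf : ∀ s : ℝ, f ∈ Φ.besovSpace s p ⊤) (m : ℕ) :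
    ∃ C : ℝ, ∀ (j : ℕ) (k : ℤ), 2 ^ (j * m) * ‖(Φ.window j k : ℂ) * f.coeff k‖ ≤ C := by
  -- With `r = min p 1`, a real number even for `p = ∞`, Nikolskii applies in L_r, and L_r is
  -- dominated by L_p on a probability space.
  obtain ⟨r, hr, hr1, hrp⟩ : ∃ r : ℝ, 0 < r ∧ r ≤ 1 ∧ ENNReal.ofReal r ≤ p := by
    have hne : min p 1 ≠ ⊤ := ((min_le_right _ _).trans_lt ENNReal.one_lt_top).ne
    refine ⟨(min p 1).toReal, ENNReal.toReal_pos (lt_min hp one_pos).ne' hne,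
      ENNReal.toReal_le_of_le_ofReal zero_le_one (by simp), ?_⟩
    rw [ENNReal.ofReal_toReal hne]
    exact min_le_left _ _
  -- The extra smoothness `1 / r` pays for the Nikolskii factor `(8 * 2 ^ j) ^ (1 / r)`.
  have hB := Φ.mem_besovSpace_top_iff.mp (hf (1 / r + m))
  set B := ⨆ j : ℕ, (2 : ℝ≥0∞) ^ (j * (1 / r + m) : ℝ) *
    eLpNorm (Φ.block f j) p haarAddCircle with hBdef
  have h8 : (8 : ℝ≥0∞) ^ (1 / r) * B ≠ ⊤ :=
    ENNReal.mul_ne_top (ENNReal.rpow_ne_top_of_nonneg (by positivity) (by simp)) hB.ne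
  refine ⟨((8 : ℝ≥0∞) ^ (1 / r) * B).toReal, fun j k => ?_⟩
  by_cases hw : Φ.window j k = 0
  · simp only [hw, Complex.ofReal_zero, zero_mul, norm_zero, mul_zero]
    exact ENNReal.toReal_nonneg
  have hcard : ((Finset.Icc (-2 ^ (j + 1) : ℤ) (2 ^ (j + 1))).card : ℝ≥0∞) ≤ 8 * 2 ^ j := by
    have : (Finset.Icc (-2 ^ (j + 1) : ℤ) (2 ^ (j + 1))).card ≤ 8 * 2 ^ j := by
      rw [Int.card_Icc]
      have : (1 : ℤ) ≤ 2 ^ j := one_le_pow₀ one_le_two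
      zify
      rw [Int.toNat_of_nonneg (by rw [pow_succ]; linarith), pow_succ]
      linarith
    exact_mod_cast this
  have hnik := enorm_coeff_le_eLpNorm _ (fun k : ℤ => (Φ.window j k : ℂ) * f.coeff k) hr hr1 k
    (Φ.mem_Icc_of_window_ne_zero hw)
  rw [← Φ.block_eq_sum f j] at hnik
  have hmono := eLpNorm_le_eLpNorm_of_exponent_le (μ := haarAddCircle) hrp
    (Φ.continuous_block f j).aestronglyMeasurable
  have key : (2 : ℝ≥0∞) ^ (j * m) * ‖(Φ.window j k : ℂ) * f.coeff k‖ₑ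
      ≤ (8 : ℝ≥0∞) ^ (1 / r) * B := by
    calc (2 : ℝ≥0∞) ^ (j * m) * ‖(Φ.window j k : ℂ) * f.coeff k‖ₑ
        ≤ 2 ^ (j * m) * ((8 * 2 ^ j) ^ (1 / r) * eLpNorm (Φ.block f j) p haarAddCircle) := by
          gcongr
          refine hnik.trans ?_
          gcongr
      _ = 8 ^ (1 / r) * (2 ^ (j * (1 / r + m) : ℝ) * eLpNorm (Φ.block f j) p haarAddCircle) := by
          rw [ENNReal.mul_rpow_of_nonneg _ _ (by positivity), mul_add,
            ENNReal.rpow_add _ _ two_ne_zero (by simp), ENNReal.rpow_mul, ENNReal.rpow_natCast,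
            ← Nat.cast_mul, ENNReal.rpow_natCast]
          ring
      _ ≤ 8 ^ (1 / r) * B := by
          gcongr
          exact le_iSup (fun j : ℕ => (2 : ℝ≥0∞) ^ (j * (1 / r + m) : ℝ) *
            eLpNorm (Φ.block f j) p haarAddCircle) j
  simpa using ENNReal.toReal_mono h8 key

/-- Since the windows sum to one, each coefficient is the sum of its windowed copies. In the
exponent `m + 1`, `m` powers of `2 ^ j` absorb `|k| ^ m ≤ 2 ^ ((j + 1) * m)`, and the last leaves a
geometric series in `j`. -/
theorem rapidDecay_coeff_of_mem_besovSpace {f : GeneralizedFunction} {p : ℝ≥0∞} (hp : 0 < p)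
    (hf : ∀ s : ℝ, f ∈ Φ.besovSpace s p ⊤) : RapidDecay f.coeff := by
  refine rapidDecay_of_bounded fun m => ?_
  obtain ⟨C, hC⟩ := Φ.exists_norm_window_coeff_le hp hf (m + 1)
  -- The final `2` is `∑ (1 / 2) ^ j`.
  refine ⟨2 ^ m * C * 2, fun k => ?_⟩
  have hsum := (Φ.hasSum_window k).mul_right (|(k : ℝ)| ^ m * ‖f.coeff k‖)
  rw [one_mul] at hsum
  refine hasSum_le (fun j => ?_) hsum (hasSum_geometric_two.mul_left (2 ^ m * C))
  have hC' := hC j k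
  rw [norm_mul, Complex.norm_real, Real.norm_of_nonneg (Φ.window_nonneg _ _), mul_comm] at hC'
  rw [one_div, inv_pow, ← div_eq_mul_inv, le_div_iff₀ (by positivity)]
  by_cases hw : Φ.window j k = 0
  · have hC0 : 0 ≤ C := le_trans (by simp [hw]) hC'
    rw [hw, zero_mul, zero_mul]
    positivity
  have h1 := pow_le_pow_left₀ (abs_nonneg _) (Φ.abs_le_of_window_ne_zero hw) m
  have h2 := mul_le_mul_of_nonneg_left h1 (mul_nonneg (mul_nonneg (Φ.window_nonneg j k)
    (norm_nonneg (f.coeff k))) (by positivity : (0 : ℝ) ≤ 2 ^ j))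
  calc Φ.window j k * (|(k : ℝ)| ^ m * ‖f.coeff k‖) * 2 ^ j
      = Φ.window j k * ‖f.coeff k‖ * 2 ^ j * |(k : ℝ)| ^ m := by ring
    _ ≤ Φ.window j k * ‖f.coeff k‖ * 2 ^ j * (2 ^ (j + 1)) ^ m := h2
    _ = 2 ^ m * (Φ.window j k * ‖f.coeff k‖ * 2 ^ (j * (m + 1))) := by ring
    _ ≤ 2 ^ m * C := by gcongr

end DyadicResolution
end PeriodicBesov

theorem mainTheorem6 (Φ : PeriodicBesov.DyadicResolution) (f : PeriodicBesov.GeneralizedFunction) :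
    (f.IsSmooth → ∀ p : ENNReal, 0 < p → Φ.criticalSmoothness f p = ⊤) ∧
    ((∃ p₀ : ENNReal, 0 < p₀ ∧ Φ.criticalSmoothness f p₀ = ⊤) →
      (∀ p : ENNReal, 0 < p → Φ.criticalSmoothness f p = ⊤) ∧ f.IsSmooth) := by
  refine ⟨fun hf p hp => Φ.criticalSmoothness_eq_top_of_rapidDecay hf.rapidDecay_coeff hp, ?_⟩
  rintro ⟨p₀, hp₀, h⟩
  have hdecay := Φ.rapidDecay_coeff_of_mem_besovSpace hp₀
    ((Φ.criticalSmoothness_eq_top_iff hp₀).mp h)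
  exact ⟨fun p hp => Φ.criticalSmoothness_eq_top_of_rapidDecay hdecay hp,
    PeriodicBesov.GeneralizedFunction.isSmooth_of_rapidDecay_coeff hdecay⟩
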